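/- An $\omega$-continuous semiring is a semiring $(S,\oplus,\odot,0,1)$ with a partial order $\le$ on $S$ such that every $\omega$-chain has a supremum, $0$ is the least element, and $\oplus$ and $\odot$ are monotone and preserve suprema of $\omega$-chains in each argument. Countable sums are the suprema of the partial sums along an enumeration. It is computable if $S$ is a computable set, the operations $\oplus$, $\odot$ and $s\mapsto s^*=\bigoplus_{i\in\mathbb N}s^i$ are computable, and $\le$ is decidable. Fix finitely many fields and finitely many values. A packet $\pi$ maps each field $f$ to a value $\pi.f$; a history is a nonempty list $\pi::\hbar$ of packets. Predicates are $t ::= \mathsf{false}\mid\mathsf{true}\mid f=v\mid t\vee t\mid t\wedge t\mid\neg t$, with their Boolean meaning on packets, and wNetKAT policies are $$p ::= t\mid f\leftarrow v\mid\mathsf{dup}\mid p;p\mid s\odot p\mid p\oplus p\mid p^*\qquad(s\in S).$$ Write $\eta(h)(h')=1$ if $h=h'$ and $0$ otherwise. The semantics $\llbracket p\rrbracket(h)(h')\in S$, the weight of output history $h'$ on input history $h$, is given by - $\llbracket t\rrbracket(\pi::\hbar)=\eta(\pi::\hbar)$ if $\pi$ satisfies $t$, and $0$ otherwise; - $\llbracket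 f\leftarrow v\rrbracket(\pi::\hbar)=\eta(\pi[f:=v]::\hbar)$, and $\llbracket\mathsf{dup}\rrbracket(\pi::\hbar)=\eta(\pi::\pi::\hbar)$; - $\llbracket p;q\rrbracket(h)(h')=\bigoplus_{h''}\llbracket p\rrbracket(h)(h'')\odot\llbracket q\rrbracket(h'')(h')$; - $\llbracket s\odot p\rrbracket(h)(h')=s\odot\llbracket p\rrbracket(h)(h')$, and $\llbracket p\oplus q\rrbracket(h)(h')=\llbracket p\rrbracket(h)(h')\oplus\llbracket q\rrbracket(h)(h')$; - $\llbracket p^*\rrbracket(h)(h')=\bigoplus_{i\in\mathbb N}\llbracket p^i\rrbracket(h)(h')$, where $p^0=\mathsf{true}$ and $p^{i+1}=p;p^i$. For $r\in S$, the policy $p$ is $r$-safe if $\llbracket p\rrbracket(\pi::\langle\rangle)(h)\le r$ for all packets $\pi$ and all histories $h$. **Theorem (Decidability of $r$-safety).** Let $S$ be a computable $\omega$-continuous semiring such that for all $s_1,s_2,s_3\in S$, $$s_1\oplus s_2\le s_3\iff s_1\le s_3\text{ and }s_2\le s_3.$$ Then it is decidable, given a wNetKAT policy $p$ with weights in $S$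 and $r\in S$, whether $p$ is $r$-safe. Moreover, if $\le$ is total, there is an algorithm that, given $p$ and $r$ such that $p$ is not $r$-safe, computes a packet $\pi$ and a history $h$ with $\llbracket p\rrbracket(\pi::\langle\rangle)(h)\not\le r$. -/

import Mathlib

/-! ### Gödel numberings of syntax trees

The two syntactic categories of the language (predicates and policies) receive a standard
effective Gödel numbering, through an auxiliary type of labelled trees. -/

namespace WNetKAT

universe u v w

/-- Finite trees whose leaves, unary nodes and binary nodes are labelled in `A`, `B`, `C`. -/
inductive PTree (A : Type u) (B : Type v) (C : Type w) : Type (max u v w)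
  | leaf : A → PTree A B C
  | un : B → PTree A B C → PTree A B C
  | bin : C → PTree A B C → PTree A B C → PTree A B C

namespace PTree

variable {A : Type u} {B : Type v} {C : Type w}

/-- The Gödel number of a tree. -/
def code [Encodable A] [Encodable B] [Encodable C] : PTree A B C → ℕ
  | leaf a => 3 * Encodable.encode a
  | un b t => 3 * Nat.pair (Encodable.encode b) t.code + 1
  | bin c t s => 3 * Nat.pair (Encodable.encode c) (Nat.pair t.code s.code) + 2

theorem snd_lt {n : ℕ} (h : n % 3 ≠ 0) : (n / 3).unpair.2 < n := by
  have := Nat.unpair_right_le (n / 3)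
  omega

theorem snd_fst_lt {n : ℕ} (h : n % 3 ≠ 0) : (n / 3).unpair.2.unpair.1 < n :=
  (Nat.unpair_left_le _).trans_lt (snd_lt h)

theorem snd_snd_lt {n : ℕ} (h : n % 3 ≠ 0) : (n / 3).unpair.2.unpair.2 < n :=
  (Nat.unpair_right_le _).trans_lt (snd_lt h)

/-- The tree with a given Gödel number, if there is one. -/
def ofCode (A : Type u) (B : Type v) (C : Type w) [Encodable A] [Encodable B] [Encodable C]
    (n : ℕ) : Option (PTree A B C) :=
  if h0 : n % 3 = 0 then
    (Encodable.decode (α := A) (n / 3)).map leaf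
  else if n % 3 = 1 then
    (Encodable.decode (α := B) (n / 3).unpair.1).bind fun b =>
      (ofCode A B C (n / 3).unpair.2).map fun t => un b t
  else
    (Encodable.decode (α := C) (n / 3).unpair.1).bind fun c =>
      (ofCode A B C (n / 3).unpair.2.unpair.1).bind fun t =>
        (ofCode A B C (n / 3).unpair.2.unpair.2).map fun s => bin c t s
termination_by n
decreasing_by
  · exact snd_lt h0
  · exact snd_fst_lt h0
  · exact snd_snd_lt h0

theorem ofCode_code [Encodable A] [Encodable B] [Encodable C] (t : PTree A B C) :
    ofCode A B C t.code = some t := by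
  induction t with
  | leaf a =>
    rw [ofCode]
    simp [code]
  | un b t ih =>
    have h1 : (un b t : PTree A B C).code % 3 = 1 := by simp only [code]; omega
    have h2 : (un b t : PTree A B C).code / 3 = Nat.pair (Encodable.encode b) t.code := by
      simp only [code]; omega
    rw [ofCode]
    simp [h1, h2, ih]
  | bin c t s iht ihs =>
    have h1 : (bin c t s : PTree A B C).code % 3 = 2 := by simp only [code]; omega
    have h2 : (bin c t s : PTree A B C).code / 3 =
        Nat.pair (Encodable.encode c) (Nat.pair t.code s.code) := by
      simp only [code]; omega
    rw [ofCode]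
    simp [h1, h2, iht, ihs]

instance instEncodable [Encodable A] [Encodable B] [Encodable C] : Encodable (PTree A B C) where
  encode := code
  decode := ofCode A B C
  encodek := ofCode_code

/-- One step of the course-of-values recursion that decodes and re-encodes a Gödel number;
`l` lists the results for all smaller numbers. -/
def step (A : Type u) (B : Type v) (C : Type w) [Encodable A] [Encodable B] [Encodable C]
    (l : List ℕ) : ℕ :=
  if l.length % 3 = 0 then
    if Encodable.encode (Encodable.decode (α := A) (l.length / 3)) = 0 then 0 else
      3 * (Encodable.encode (Encodable.decode (α := A) (l.length / 3)) - 1) + 1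
  else if l.length % 3 = 1 then
    if Encodable.encode (Encodable.decode (α := B) (l.length / 3).unpair.1) = 0 then 0 else
    if l.getD (l.length / 3).unpair.2 0 = 0 then 0 else
      3 * Nat.pair (Encodable.encode (Encodable.decode (α := B) (l.length / 3).unpair.1) - 1)
        (l.getD (l.length / 3).unpair.2 0 - 1) + 1 + 1
  else
    if Encodable.encode (Encodable.decode (α := C) (l.length / 3).unpair.1) = 0 then 0 else
    if l.getD (l.length / 3).unpair.2.unpair.1 0 = 0 then 0 else
    if l.getD (l.length / 3).unpair.2.unpair.2 0 = 0 then 0 else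
      3 * Nat.pair (Encodable.encode (Encodable.decode (α := C) (l.length / 3).unpair.1) - 1)
        (Nat.pair (l.getD (l.length / 3).unpair.2.unpair.1 0 - 1)
          (l.getD (l.length / 3).unpair.2.unpair.2 0 - 1)) + 2 + 1

theorem step_eq [Encodable A] [Encodable B] [Encodable C] (n : ℕ) :
    step A B C ((List.range n).map fun i => Encodable.encode (ofCode A B C i)) =
      Encodable.encode (ofCode A B C n) := by
  have hget : ∀ i, i < n →
      ((List.range n).map fun i => Encodable.encode (ofCode A B C i)).getD i 0 =
        Encodable.encode (ofCode A B C i) := by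
    intro i hi
    simp [List.getD, hi]
  have hlen : ((List.range n).map fun i => Encodable.encode (ofCode A B C i)).length = n := by
    simp
  rw [step, hlen, ofCode]
  by_cases h0 : n % 3 = 0
  · rw [if_pos h0, dif_pos h0]
    cases Encodable.decode (α := A) (n / 3) with
    | none => simp
    | some a => simp; rfl
  · rw [if_neg h0, dif_neg h0, hget _ (snd_lt h0), hget _ (snd_fst_lt h0), hget _ (snd_snd_lt h0)]
    by_cases h1 : n % 3 = 1
    · rw [if_pos h1, if_pos h1]
      cases Encodable.decode (α := B) (n / 3).unpair.1 with
      | none => simp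
      | some b =>
        cases ofCode A B C (n / 3).unpair.2 with
        | none => simp
        | some t => simp; rfl
    · rw [if_neg h1, if_neg h1]
      cases Encodable.decode (α := C) (n / 3).unpair.1 with
      | none => simp
      | some c =>
        cases ofCode A B C (n / 3).unpair.2.unpair.1 with
        | none => simp
        | some t =>
          cases ofCode A B C (n / 3).unpair.2.unpair.2 with
          | none => simp
          | some s => simp; rfl

open Primrec in
theorem primrec_step [Primcodable A] [Primcodable B] [Primcodable C] :
    Primrec (step A B C) := by
  have three : Primrec fun _ : List ℕ => 3 := const 3
  have hm : Primrec fun l : List ℕ => l.length / 3 := nat_div.comp list_length three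
  have hr : Primrec fun l : List ℕ => l.length % 3 := nat_mod.comp list_length three
  have h1 : Primrec fun l : List ℕ => (l.length / 3).unpair.1 := fst.comp (unpair.comp hm)
  have h2 : Primrec fun l : List ℕ => (l.length / 3).unpair.2 := snd.comp (unpair.comp hm)
  have h21 : Primrec fun l : List ℕ => (l.length / 3).unpair.2.unpair.1 :=
    fst.comp (unpair.comp h2)
  have h22 : Primrec fun l : List ℕ => (l.length / 3).unpair.2.unpair.2 :=
    snd.comp (unpair.comp h2)
  have hget : ∀ {f : List ℕ → ℕ}, Primrec f → Primrec fun l : List ℕ => l.getD (f l) 0 :=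
    fun hf => (list_getD 0).comp Primrec.id hf
  have hz : ∀ {f g : List ℕ → ℕ}, Primrec f → Primrec g →
      Primrec fun l => if f l = 0 then 0 else g l :=
    fun hf hg => Primrec.ite (PrimrecRel.comp Primrec.eq hf (const 0)) (const 0) hg
  have hp : ∀ {f : List ℕ → ℕ}, Primrec f → Primrec fun l => f l - 1 :=
    fun hf => nat_sub.comp hf (const 1)
  have ha : ∀ {f : List ℕ → ℕ} (c : ℕ), Primrec f → Primrec fun l => 3 * f l + c :=
    fun c hf => nat_add.comp (nat_mul.comp three hf) (const c)
  have eA := (Primrec.encdec (α := A)).comp hm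
  have eB := (Primrec.encdec (α := B)).comp h1
  have eC := (Primrec.encdec (α := C)).comp h1
  refine Primrec.ite (PrimrecRel.comp Primrec.eq hr (const 0)) (hz eA (ha 1 (hp eA)))
    (Primrec.ite (PrimrecRel.comp Primrec.eq hr (const 1))
      (hz eB (hz (hget h2) (succ.comp (ha 1 (Primrec₂.natPair.comp (hp eB) (hp (hget h2)))))))
      (hz eC (hz (hget h21) (hz (hget h22) (succ.comp (ha 2 (Primrec₂.natPair.comp (hp eC)
        (Primrec₂.natPair.comp (hp (hget h21)) (hp (hget h22))))))))))

instance instPrimcodable [Primcodable A] [Primcodable B] [Primcodable C] :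
    Primcodable (PTree A B C) where
  prim := by
    have h : Primrec₂ fun (_ : Unit) (n : ℕ) => Encodable.encode (ofCode A B C n) :=
      Primrec.nat_strong_rec _ (g := fun _ l => some (step A B C l))
        ((Primrec.option_some.comp (primrec_step.comp Primrec.snd)).to₂)
        (fun _ n => congrArg some (step_eq n))
    exact Primrec.nat_iff.1 (h.comp (Primrec.const ()) Primrec.id)

end PTree

/-! ### `ω`-continuous semirings -/

open OmegaCompletePartialOrder

/-- An `ω`-continuous semiring: a semiring with an `ω`-complete partial order whose least element
is `0` and for which addition and multiplication are monotone and preserve suprema of `ω`-chains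
in each argument (`ωScottContinuous` includes monotonicity; addition is commutative). -/
class OmegaContinuousSemiring (S : Type u) extends Semiring S, OmegaCompletePartialOrder S where
  zero_least : ∀ s : S, 0 ≤ s
  add_continuous : ∀ s : S, ωScottContinuous fun x : S => s + x
  mul_left_continuous : ∀ s : S, ωScottContinuous fun x : S => s * x
  mul_right_continuous : ∀ s : S, ωScottContinuous fun x : S => x * s

section Sums

variable {S : Type u} [OmegaContinuousSemiring S]

theorem monotone_partialSums (f : ℕ → S) : Monotone fun n => ∑ i ∈ Finset.range n, f i := by
  refine monotone_nat_of_le_succ fun n => ?_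
  rw [Finset.sum_range_succ]
  simpa using (OmegaContinuousSemiring.add_continuous
    (∑ i ∈ Finset.range n, f i)).monotone (OmegaContinuousSemiring.zero_least (f n))

/-- The sum of a sequence: the supremum of its partial sums. -/
def omegaSum (f : ℕ → S) : S :=
  ωSup ⟨fun n => ∑ i ∈ Finset.range n, f i, monotone_partialSums f⟩

/-- The sum of a family indexed by a countable type, taken along an enumeration of the index type
(indices `n` that enumerate nothing contribute `0`). -/
def countableSum {I : Type v} [Encodable I] (f : I → S) : S :=
  omegaSum fun n => ((Encodable.decode (α := I) n).map f).getD 0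

/-- The closure operation `s* = ∑ₙ sⁿ`. -/
def closure (s : S) : S := omegaSum fun n => s ^ n

end Sums

/-- A computable semiring: its elements have codes that form a decidable set (`Primcodable S`),
addition, multiplication and closure are computable on codes, and the order is decidable. -/
class ComputableSemiring (S : Type u) [OmegaContinuousSemiring S] [Primcodable S] : Prop where
  computable_add : Computable₂ fun a b : S => a + b
  computable_mul : Computable₂ fun a b : S => a * b
  computable_closure : Computable fun a : S => closure a
  decidable_le : ComputablePred fun x : S × S => x.1 ≤ x.2

/-! ### Syntax

There are `k` fields and `n` values; a packet assigns a value to every field. -/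

/-- Packets. -/
abbrev Packet (k n : ℕ) := Fin k → Fin n

/-- Histories: nonempty lists of packets, as a head packet together with the tail. -/
abbrev History (k n : ℕ) := Packet k n × List (Packet k n)

/-- Predicates. -/
inductive Pred (k n : ℕ) : Type
  | false : Pred k n
  | true : Pred k n
  | test : Fin k → Fin n → Pred k n
  | or : Pred k n → Pred k n → Pred k n
  | and : Pred k n → Pred k n → Pred k n
  | not : Pred k n → Pred k n

/-- Policies with weights in `S`: filters, modifications `f ← v`, duplication, sequential
composition, weighting `s ⊙ p`, choice and iteration. -/
inductive Policy (k n : ℕ) (S : Type u) : Type u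
  | filter : Pred k n → Policy k n S
  | modify : Fin k → Fin n → Policy k n S
  | dup : Policy k n S
  | seq : Policy k n S → Policy k n S → Policy k n S
  | weight : S → Policy k n S → Policy k n S
  | choice : Policy k n S → Policy k n S → Policy k n S
  | iter : Policy k n S → Policy k n S

namespace Pred

variable {k n : ℕ}

/-- The syntax tree of a predicate. -/
def toTree : Pred k n → PTree (Bool ⊕ (Fin k × Fin n)) Unit Bool
  | .false => .leaf (.inl Bool.false)
  | .true => .leaf (.inl Bool.true)
  | .test f v => .leaf (.inr (f, v))
  | .or t u => .bin Bool.false t.toTree u.toTree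
  | .and t u => .bin Bool.true t.toTree u.toTree
  | .not t => .un () t.toTree

/-- The predicate with a given syntax tree. -/
def ofTree : PTree (Bool ⊕ (Fin k × Fin n)) Unit Bool → Pred k n
  | .leaf (.inl Bool.false) => .false
  | .leaf (.inl Bool.true) => .true
  | .leaf (.inr (f, v)) => .test f v
  | .bin Bool.false t u => .or (ofTree t) (ofTree u)
  | .bin Bool.true t u => .and (ofTree t) (ofTree u)
  | .un () t => .not (ofTree t)

theorem ofTree_toTree (t : Pred k n) : ofTree t.toTree = t := by
  induction t <;> simp_all [toTree, ofTree]

theorem toTree_ofTree (t : PTree (Bool ⊕ (Fin k × Fin n)) Unit Bool) :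
    (ofTree t).toTree = t := by
  induction t with
  | leaf a => rcases a with (_ | _) | ⟨f, v⟩ <;> rfl
  | un b t ih => simp [toTree, ofTree, ih]
  | bin c t u iht ihu => cases c <;> simp [toTree, ofTree, iht, ihu]

instance instPrimcodable : Primcodable (Pred k n) :=
  Primcodable.ofEquiv _ ⟨toTree, ofTree, ofTree_toTree, toTree_ofTree⟩

end Pred

namespace Policy

variable {k n : ℕ} {S : Type u}

/-- The syntax tree of a policy. -/
def toTree : Policy k n S → PTree (Pred k n ⊕ ((Fin k × Fin n) ⊕ Unit)) (S ⊕ Unit) Bool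
  | .filter t => .leaf (.inl t)
  | .modify f v => .leaf (.inr (.inl (f, v)))
  | .dup => .leaf (.inr (.inr ()))
  | .seq p q => .bin Bool.false p.toTree q.toTree
  | .weight s p => .un (.inl s) p.toTree
  | .choice p q => .bin Bool.true p.toTree q.toTree
  | .iter p => .un (.inr ()) p.toTree

/-- The policy with a given syntax tree. -/
def ofTree : PTree (Pred k n ⊕ ((Fin k × Fin n) ⊕ Unit)) (S ⊕ Unit) Bool → Policy k n S
  | .leaf (.inl t) => .filter t
  | .leaf (.inr (.inl (f, v))) => .modify f v
  | .leaf (.inr (.inr ())) => .dup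
  | .bin Bool.false p q => .seq (ofTree p) (ofTree q)
  | .un (.inl s) p => .weight s (ofTree p)
  | .bin Bool.true p q => .choice (ofTree p) (ofTree q)
  | .un (.inr ()) p => .iter (ofTree p)

theorem ofTree_toTree (p : Policy k n S) : ofTree p.toTree = p := by
  induction p <;> simp_all [toTree, ofTree]

theorem toTree_ofTree (t : PTree (Pred k n ⊕ ((Fin k × Fin n) ⊕ Unit)) (S ⊕ Unit) Bool) :
    (ofTree t).toTree = t := by
  induction t with
  | leaf a => rcases a with t | ⟨f, v⟩ | _ <;> rfl
  | un b t ih => rcases b with s | _ <;> simp [toTree, ofTree, ih]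
  | bin c t u iht ihu => cases c <;> simp [toTree, ofTree, iht, ihu]

/-- Policies are finite syntactic objects, given to algorithms by their Gödel numbers. -/
instance instPrimcodable [Primcodable S] : Primcodable (Policy k n S) :=
  Primcodable.ofEquiv _ ⟨toTree, ofTree, ofTree_toTree, toTree_ofTree⟩

end Policy

/-! ### Semantics -/

/-- The semantics of predicates. -/
def Pred.eval {k n : ℕ} : Pred k n → Packet k n → Bool
  | .false, _ => Bool.false
  | .true, _ => Bool.true
  | .test f v, π => decide (π f = v)
  | .or t u, π => t.eval π || u.eval π
  | .and t u, π => t.eval π && u.eval π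
  | .not t, π => !t.eval π

section Semantics

variable {S : Type u} [OmegaContinuousSemiring S]

/-- The unit of weightings: `η x` has weight `1` at `x` and `0` elsewhere. Weightings are functions
to `S` with countable support; as the sets used here are countable, every function qualifies. -/
def eta {X : Type v} [DecidableEq X] (x : X) : X → S := fun y => if x = y then 1 else 0

/-- The bind of weightings over a countable set. Points outside the support of `m` contribute
`0 * f x y = 0`, so the sum may run over all of `X`. -/
def bind {X : Type v} [Encodable X] (m : X → S) (f : X → X → S) : X → S :=
  fun y => countableSum fun x => m x * f x y

/-- The `i`-fold sequential composition of a semantic function with itself. -/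
def iterate {X : Type v} [Encodable X] [DecidableEq X] (f : X → X → S) : ℕ → X → X → S
  | 0 => eta
  | i + 1 => fun x => bind (f x) (iterate f i)

/-- The denotational semantics: `p.sem h h'` is the weight of the output history `h'` when `p` is
executed on the input history `h`. -/
def Policy.sem {k n : ℕ} : Policy k n S → History k n → History k n → S
  | .filter t, h => fun h' => (if t.eval h.1 then 1 else 0) * eta h h'
  | .modify f v, h => eta (Function.update h.1 f v, h.2)
  | .dup, h => eta (h.1, h.1 :: h.2)
  | .seq p q, h => bind (p.sem h) q.sem
  | .weight s p, h => fun h' => s * p.sem h h'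
  | .choice p q, h => fun h' => p.sem h h' + q.sem h h'
  | .iter p, h => fun h' => omegaSum fun i => iterate p.sem i h h'

/-- The syntactic power `pⁱ`, with `p⁰ = skip` and `pⁱ⁺¹ = p ; pⁱ`. -/
def Policy.pow {k n : ℕ} (p : Policy k n S) : ℕ → Policy k n S
  | 0 => .filter .true
  | i + 1 => .seq p (p.pow i)

theorem Policy.sem_pow {k n : ℕ} (p : Policy k n S) (i : ℕ) :
    (p.pow i).sem = iterate p.sem i := by
  induction i with
  | zero => funext h h'; simp [Policy.pow, Policy.sem, iterate, Pred.eval]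
  | succ i ih => funext h; simp [Policy.pow, Policy.sem, iterate, ih]

/-- The semantics of iteration is the sum of the semantics of the powers `pⁱ`. -/
theorem Policy.sem_iter {k n : ℕ} (p : Policy k n S) (h h' : History k n) :
    (Policy.iter p).sem h h' = omegaSum fun i => (p.pow i).sem h h' := by
  simp only [Policy.sem, Policy.sem_pow]

/-- `p` is `r`-safe: on every one-packet input history, every output history has weight at most
`r`. -/
def Policy.Safe {k n : ℕ} (p : Policy k n S) (r : S) : Prop :=
  ∀ (π : Packet k n) (h : History k n), p.sem (π, []) h ≤ r

end Semantics

end WNetKAT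

namespace WNetKAT

universe u v w

/-! ### Closure properties of computable functions -/

section Computability

variable {α β γ σ : Type*} [Primcodable α] [Primcodable β] [Primcodable γ] [Primcodable σ]

/-! The hypothesis on addition says that `a + b` is the supremum of `a` and `b`, so finite and
countable sums are suprema: a sum lies below `r` exactly when each term does, and by continuity the
same holds inside a context `a * _ * b`.

Decidability. There are infinitely many output histories, but a policy only ever inspects the head
packet of its input. Hence one may take, for each pair of packets, the supremum of the weights over
all tails of the output. These suprema form a finite matrix, built compositionally: sequencing is
the matrix product, and iteration the sum of all powers. That sum is computed by
Floyd–Warshall–Kleene elimination (`matrixClosure_eq_omegaSum`), which uses only addition,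
multiplication and scalar closure. The invariant is `Policy.mul_sem_mul_le_iff`, and safety becomes
finitely many comparisons (`Policy.safe_iff`).

Witnesses. The matrix forgets the tails, so histories are recovered from runs: individual executions
with their weights and the packets they produce, every iteration being unrolled at most `m` times.
The weight of a run is below the semantics at the history it produces (`Policy.runs_sound`), and the
semantics is below every common bound of the runs (`Policy.runs_complete`). If `p` is not `r`-safe,
some run therefore has weight not below `r`. Searching for it over increasing `m` terminates, and it
yields the packet and the history. -/

theorem computable_ite {c : α → Prop} [DecidablePred c] {f g : α → σ}
    (hc : Computable fun a => decide (c a)) (hf : Computable f) (hg : Computable g) :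
    Computable fun a => if c a then f a else g a :=
  (Computable.cond hc hf hg).of_eq fun a => by by_cases h : c a <;> simp [h]

theorem computable_list_all {ι : Type*} (l : List ι) {f : α → ι → Bool}
    (hf : ∀ i, Computable fun a => f a i) : Computable fun a => l.all (f a) := by
  induction l with
  | nil => exact Computable.const true
  | cons i l ih => exact (Primrec.and.to_comp.comp (hf i) ih).of_eq fun a => by simp

theorem computable_finset_sum [AddCommMonoid σ] (hadd : Computable₂ fun a b : σ => a + b)
    {ι : Type*} (s : Finset ι) {f : α → ι → σ} (hf : ∀ i, Computable fun a => f a i) :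
    Computable fun a => ∑ i ∈ s, f a i := by
  classical
  induction s using Finset.induction_on with
  | empty => exact (Computable.const 0).of_eq fun a => by simp
  | insert i s hi ih =>
    exact (hadd.comp (hf i) ih).of_eq fun a => (Finset.sum_insert hi).symm

/-- A fold is a recursion on natural numbers whose state is the unread part of the list together
with the accumulator, run for as many steps as the list is long. -/
theorem computable_list_foldl {f : α → List β} {g : α → σ} {h : α → σ → β → σ}
    (hf : Computable f) (hg : Computable g)
    (hh : Computable fun x : α × σ × β => h x.1 x.2.1 x.2.2) :
    Computable fun a => (f a).foldl (h a) (g a) := by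
  let F : α → ℕ → List β × σ := fun a m =>
    Nat.rec (f a, g a) (fun _ s =>
      ((s.1.tail, (s.1.head?.map fun b => h a s.2 b).getD s.2) : List β × σ)) m
  have hF : Computable fun a => (F a (f a).length).2 := by
    refine Computable.snd.comp (Computable.nat_rec (h := fun a x =>
      (x.2.1.tail, (x.2.1.head?.map fun b => h a x.2.2 b).getD x.2.2))
      (Computable.list_length.comp hf) (Computable.pair hf hg) ?_)
    have hs : Computable fun x : α × ℕ × List β × σ => x.2.2.2 :=
      Computable.snd.comp (Computable.snd.comp Computable.snd)
    have hl : Computable fun x : α × ℕ × List β × σ => x.2.2.1 :=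
      Computable.fst.comp (Computable.snd.comp Computable.snd)
    refine Computable.pair (Primrec.list_tail.to_comp.comp hl) (Computable.option_getD
      (Computable.option_map (Primrec.list_head?.to_comp.comp hl) ?_) hs)
    exact hh.comp (Computable.pair (Computable.fst.comp Computable.fst)
      (Computable.pair (hs.comp Computable.fst) Computable.snd))
  refine hF.of_eq fun a => ?_
  -- Loop invariant: once the prefix `l₀` is read, the state is the remaining list `l` and the fold
  -- over `l₀`; exactly `l.length` steps remain.
  have key : ∀ (l : List β) (m : ℕ), m = l.length → ∀ l₀ : List β, f a = l₀ ++ l →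
      F a l₀.length = (l, l₀.foldl (h a) (g a)) →
      (F a (l₀.length + m)).2 = (l₀ ++ l).foldl (h a) (g a) := by
    intro l
    induction l with
    | nil => rintro m rfl l₀ - h0; simp [h0]
    | cons b l ih =>
      rintro m rfl l₀ hl h0
      have h1 : F a (l₀ ++ [b]).length = (l, (l₀ ++ [b]).foldl (h a) (g a)) := by
        have : F a (l₀.length + 1) = ((F a l₀.length).1.tail,
          ((F a l₀.length).1.head?.map fun b => h a (F a l₀.length).2 b).getD
            (F a l₀.length).2) := rfl
        simp [this, h0]
      have := ih _ rfl (l₀ ++ [b]) (by simp [hl]) h1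
      rw [List.append_cons, ← this, List.length_append, List.length_cons, List.length_singleton,
        Nat.add_assoc, Nat.add_comm 1]
  simpa using key (f a) _ rfl [] rfl rfl

theorem computable_list_flatMap {f : α → List β} {g : α → β → List σ}
    (hf : Computable f) (hg : Computable₂ g) : Computable fun a => (f a).flatMap (g a) := by
  refine (computable_list_foldl (h := fun a s b => s ++ g a b) hf (Computable.const [])
    (Computable.list_append.comp (Computable.fst.comp Computable.snd)
      (hg.comp Computable.fst (Computable.snd.comp Computable.snd)))).of_eq fun a => ?_
  suffices ∀ (l : List β) (s : List σ), l.foldl (fun s b => s ++ g a b) s = s ++ l.flatMap (g a) by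
    simpa using this (f a) []
  intro l
  induction l with
  | nil => simp
  | cons b l ih => intro s; simp [ih]

theorem computable_list_map {f : α → List β} {g : α → β → σ}
    (hf : Computable f) (hg : Computable₂ g) : Computable fun a => (f a).map (g a) :=
  (computable_list_flatMap (g := fun a b => [g a b]) hf
    (Computable.list_cons.comp hg (Computable.const []))).of_eq fun a => by
      simp [← List.map_eq_flatMap]

theorem computable_list_find? {f : α → List β} {g : α → β → Bool}
    (hf : Computable f) (hg : Computable₂ g) : Computable fun a => (f a).find? (g a) := by
  refine (Primrec.list_head?.to_comp.comp (computable_list_flatMap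
    (g := fun a b => bif g a b then [b] else []) hf
    (Computable.cond hg (Computable.list_cons.comp Computable.snd (Computable.const []))
      (Computable.const [])))).of_eq fun a => ?_
  induction f a with
  | nil => rfl
  | cons b l ih => cases h : g a b <;> simp_all

end Computability

/-! ### Recursion on trees -/

namespace PTree

variable {A : Type u} {B : Type v} {C : Type w}

/-- Structural recursion on trees. -/
def fold {T : Type*} (fl : A → T) (fu : B → T → T) (fb : C → T → T → T) : PTree A B C → T
  | leaf a => fl a
  | un b t => fu b (t.fold fl fu fb)
  | bin c t s => fb c (t.fold fl fu fb) (s.fold fl fu fb)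

variable {α T : Type*} [Primcodable α] [Primcodable A] [Primcodable B] [Primcodable C]

/-- One step of the course-of-values recursion that folds the tree with a given Gödel number;
`l` lists the results for all smaller numbers. -/
def foldStep (fl : A → T) (fu : B → T → T) (fb : C → T → T → T) (l : List (Option T)) :
    Option T :=
  if l.length % 3 = 0 then
    (Encodable.decode (α := A) (l.length / 3)).map fl
  else if l.length % 3 = 1 then
    (Encodable.decode (α := B) (l.length / 3).unpair.1).bind fun b =>
      (l[(l.length / 3).unpair.2]?.getD none).map fun t => fu b t
  else
    (Encodable.decode (α := C) (l.length / 3).unpair.1).bind fun c =>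
      (l[(l.length / 3).unpair.2.unpair.1]?.getD none).bind fun t =>
        (l[(l.length / 3).unpair.2.unpair.2]?.getD none).map fun s => fb c t s

/-- The codes of the immediate subtrees are smaller than the code of the tree, so the table already
contains their results and no lookup falls outside it. -/
theorem foldStep_eq (fl : A → T) (fu : B → T → T) (fb : C → T → T → T) (n : ℕ) :
    foldStep fl fu fb ((List.range n).map fun i => (ofCode A B C i).map (fold fl fu fb)) =
      (ofCode A B C n).map (fold fl fu fb) := by
  have hget : ∀ i, i < n →
      ((List.range n).map fun i => (ofCode A B C i).map (fold fl fu fb))[i]?.getD none =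
        (ofCode A B C i).map (fold fl fu fb) := by
    intro i hi
    simp [hi]
  have hlen : ((List.range n).map fun i => (ofCode A B C i).map (fold fl fu fb)).length = n := by
    simp
  rw [foldStep, hlen, ofCode]
  by_cases h0 : n % 3 = 0
  · rw [if_pos h0, dif_pos h0]
    cases Encodable.decode (α := A) (n / 3) <;> simp [fold]
  · rw [if_neg h0, dif_neg h0, hget _ (snd_lt h0), hget _ (snd_fst_lt h0), hget _ (snd_snd_lt h0)]
    by_cases h1 : n % 3 = 1
    · rw [if_pos h1, if_pos h1]
      cases Encodable.decode (α := B) (n / 3).unpair.1 with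
      | none => simp
      | some b => cases ofCode A B C (n / 3).unpair.2 <;> simp [fold]
    · rw [if_neg h1, if_neg h1]
      cases Encodable.decode (α := C) (n / 3).unpair.1 with
      | none => simp
      | some c =>
        cases ofCode A B C (n / 3).unpair.2.unpair.1 with
        | none => simp
        | some t => cases ofCode A B C (n / 3).unpair.2.unpair.2 <;> simp [fold]

-- Structural recursion is course-of-values recursion on Gödel numbers. The parameter in `α` lets
-- the branch functions depend on a further input.
open Computable in
theorem computable_fold [Primcodable T] {fl : α → A → T} {fu : α → B → T → T} {fb : α → C → T → T → T}
    (hl : Computable fun x : α × A => fl x.1 x.2)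
    (hu : Computable fun x : α × B × T => fu x.1 x.2.1 x.2.2)
    (hb : Computable fun x : α × C × T × T => fb x.1 x.2.1 x.2.2.1 x.2.2.2) :
    Computable fun x : α × PTree A B C => x.2.fold (fl x.1) (fu x.1) (fb x.1) := by
  have hlen : Computable fun x : α × List (Option T) => x.2.length := list_length.comp snd
  have hm : Computable fun x : α × List (Option T) => x.2.length / 3 :=
    Primrec.nat_div.to_comp.comp hlen (const 3)
  have hr : Computable fun x : α × List (Option T) => x.2.length % 3 :=
    Primrec.nat_mod.to_comp.comp hlen (const 3)
  have h1 : Computable fun x : α × List (Option T) => (x.2.length / 3).unpair.1 :=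
    fst.comp (unpair.comp hm)
  have h2 : Computable fun x : α × List (Option T) => (x.2.length / 3).unpair.2 :=
    snd.comp (unpair.comp hm)
  have h21 : Computable fun x : α × List (Option T) => (x.2.length / 3).unpair.2.unpair.1 :=
    fst.comp (unpair.comp h2)
  have h22 : Computable fun x : α × List (Option T) => (x.2.length / 3).unpair.2.unpair.2 :=
    snd.comp (unpair.comp h2)
  have hget : ∀ {f : α × List (Option T) → ℕ}, Computable f →
      Computable fun x : α × List (Option T) => x.2[f x]?.getD none :=
    fun hf => option_getD (list_getElem?.comp snd hf) (const none)
  have hdec : ∀ c : ℕ, Computable fun x : α × List (Option T) => decide (x.2.length % 3 = c) :=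
    fun c => (Primrec.eq (α := ℕ)).decide.to_comp.comp hr (const c)
  have hleaf : Computable fun x : α × List (Option T) =>
      (Encodable.decode (α := A) (x.2.length / 3)).map (fl x.1) :=
    option_map (Computable.decode.comp hm) (hl.comp (pair (fst.comp fst) snd))
  have hun : Computable fun x : α × List (Option T) =>
      (Encodable.decode (α := B) (x.2.length / 3).unpair.1).bind fun b =>
        (x.2[(x.2.length / 3).unpair.2]?.getD none).map fun t => fu x.1 b t := by
    have h : Computable₂ fun (y : (α × List (Option T)) × B) (t : T) => fu y.1.1 y.2 t := by
      have hp : Computable fun z : ((α × List (Option T)) × B) × T => (z.1.1.1, z.1.2, z.2) :=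
        pair (fst.comp (fst.comp fst)) (pair (snd.comp fst) snd)
      have h := Computable.comp hu hp
      exact h
    exact option_bind (Computable.decode.comp h1) (option_map ((hget h2).comp fst) h)
  have hbin : Computable fun x : α × List (Option T) =>
      (Encodable.decode (α := C) (x.2.length / 3).unpair.1).bind fun c =>
        (x.2[(x.2.length / 3).unpair.2.unpair.1]?.getD none).bind fun t =>
          (x.2[(x.2.length / 3).unpair.2.unpair.2]?.getD none).map fun s => fb x.1 c t s := by
    have h : Computable₂ fun (y : ((α × List (Option T)) × C) × T) (s : T) =>
        fb y.1.1.1 y.1.2 y.2 s := by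
      have hp : Computable fun z : (((α × List (Option T)) × C) × T) × T =>
          (z.1.1.1.1, z.1.1.2, z.1.2, z.2) :=
        pair (fst.comp (fst.comp (fst.comp fst)))
          (pair (snd.comp (fst.comp fst)) (pair (snd.comp fst) snd))
      have h := Computable.comp hb hp
      exact h
    have h' : Computable₂ fun (y : (α × List (Option T)) × C) (t : T) =>
        (y.1.2[(y.1.2.length / 3).unpair.2.unpair.2]?.getD none).map fun s => fb y.1.1 y.2 t s :=
      option_map ((hget h22).comp (fst.comp fst)) h
    exact option_bind (Computable.decode.comp h1) (option_bind ((hget h21).comp fst) h')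
  have hstep : Computable₂ fun (a : α) (l : List (Option T)) =>
      foldStep (fl a) (fu a) (fb a) l :=
    computable_ite (hdec 0) hleaf (computable_ite (hdec 1) hun hbin)
  have hrec : Computable₂ fun (a : α) (n : ℕ) =>
      (ofCode A B C n).map (fold (fl a) (fu a) (fb a)) :=
    nat_strong_rec _ (g := fun a l => some (foldStep (fl a) (fu a) (fb a) l))
      (option_some.comp hstep) fun a n => congrArg some (foldStep_eq _ _ _ n)
  refine option_some_iff.1 ((hrec.comp fst (Computable.encode.comp snd)).of_eq fun x => ?_)
  change (ofCode A B C x.2.code).map _ = _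
  rw [ofCode_code]
  rfl

end PTree

/-! ### Recursion on predicates and policies -/

theorem Pred.computable_toTree {k n : ℕ} : Computable (Pred.toTree (k := k) (n := n)) :=
  (Primrec.of_equiv (e := (⟨Pred.toTree, Pred.ofTree, Pred.ofTree_toTree, Pred.toTree_ofTree⟩ :
    Pred k n ≃ PTree (Bool ⊕ (Fin k × Fin n)) Unit Bool))).to_comp

theorem Policy.computable_toTree {k n : ℕ} {S : Type u} [Primcodable S] :
    Computable (Policy.toTree (k := k) (n := n) (S := S)) :=
  (Primrec.of_equiv (e := (⟨Policy.toTree, Policy.ofTree, Policy.ofTree_toTree,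
    Policy.toTree_ofTree⟩ : Policy k n S ≃
      PTree (Pred k n ⊕ ((Fin k × Fin n) ⊕ Unit)) (S ⊕ Unit) Bool))).to_comp

/-- Evaluation is a fold with the packet as parameter, and all its branch functions have finite
domains. -/
theorem Pred.computable_eval {k n : ℕ} :
    Computable₂ fun (t : Pred k n) (π : Packet k n) => t.eval π := by
  let fl : Packet k n → Bool ⊕ (Fin k × Fin n) → Bool := fun π a =>
    Sum.elim id (fun y => decide (π y.1 = y.2)) a
  let fb : Bool → Bool → Bool → Bool := fun c a b => bif c then a && b else a || b
  have hl : Computable fun x : Packet k n × (Bool ⊕ (Fin k × Fin n)) => fl x.1 x.2 :=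
    (Primrec.dom_finite _).to_comp
  have hu : Computable fun x : Packet k n × Unit × Bool => !x.2.2 :=
    (Primrec.dom_finite _).to_comp
  have hb : Computable fun x : Packet k n × Bool × Bool × Bool => fb x.2.1 x.2.2.1 x.2.2.2 :=
    (Primrec.dom_finite _).to_comp
  have h := PTree.computable_fold (fl := fl) (fu := fun _ _ b => !b) (fb := fun _ => fb) hl hu hb
  have hp : Computable fun x : Pred k n × Packet k n => (x.2, x.1.toTree) :=
    Computable.pair Computable.snd (Pred.computable_toTree.comp Computable.fst)
  refine Computable₂.mk ((Computable.comp h hp).of_eq fun x => ?_)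
  obtain ⟨t, π⟩ := x
  induction t <;> simp_all [Pred.toTree, PTree.fold, Pred.eval, fl, fb]

/-- Structural recursion on policies. -/
def Policy.fold {k n : ℕ} {S : Type u} {T : Type v} (ffilter : Pred k n → T)
    (fmodify : Fin k → Fin n → T) (fdup : T) (fseq : T → T → T) (fweight : S → T → T)
    (fchoice : T → T → T) (fiter : T → T) : Policy k n S → T
  | .filter t => ffilter t
  | .modify f v => fmodify f v
  | .dup => fdup
  | .seq p q => fseq (p.fold ffilter fmodify fdup fseq fweight fchoice fiter)
      (q.fold ffilter fmodify fdup fseq fweight fchoice fiter)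
  | .weight s p => fweight s (p.fold ffilter fmodify fdup fseq fweight fchoice fiter)
  | .choice p q => fchoice (p.fold ffilter fmodify fdup fseq fweight fchoice fiter)
      (q.fold ffilter fmodify fdup fseq fweight fchoice fiter)
  | .iter p => fiter (p.fold ffilter fmodify fdup fseq fweight fchoice fiter)

-- Only the iteration branch takes the parameter: it will be the unrolling bound for runs.
-- Modification and duplication have finitely many instances, so their branches need no
-- computability assumption.
open Computable in
theorem Policy.computable_fold {k n : ℕ} {S : Type u} [Primcodable S] {α : Type w} {T : Type v}
    [Primcodable α] [Primcodable T] {ffilter : Pred k n → T}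
    {fmodify : Fin k → Fin n → T} {fdup : T} {fseq : T → T → T} {fweight : S → T → T}
    {fchoice : T → T → T} {fiter : α → T → T} (hfilter : Computable ffilter)
    (hseq : Computable₂ fseq) (hweight : Computable₂ fweight) (hchoice : Computable₂ fchoice)
    (hiter : Computable₂ fiter) :
    Computable₂ fun (a : α) (p : Policy k n S) =>
      p.fold ffilter fmodify fdup fseq fweight fchoice (fiter a) := by
  let fl : Pred k n ⊕ ((Fin k × Fin n) ⊕ Unit) → T := fun l =>
    Sum.casesOn l ffilter (Sum.elim (fun y => fmodify y.1 y.2) fun _ => fdup)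
  let fu : α → S ⊕ Unit → T → T := fun a b t =>
    Sum.casesOn b (fun s => fweight s t) fun _ => fiter a t
  let fb : Bool → T → T → T := fun c t s => bif c then fchoice t s else fseq t s
  have hl : Computable fun x : α × (Pred k n ⊕ ((Fin k × Fin n) ⊕ Unit)) => fl x.2 :=
    sumCasesOn snd (hfilter.comp snd) ((Primrec.dom_finite _).to_comp.comp snd)
  have hu : Computable fun x : α × (S ⊕ Unit) × T => fu x.1 x.2.1 x.2.2 :=
    sumCasesOn (fst.comp snd) (hweight.comp snd (snd.comp (snd.comp fst)))
      (hiter.comp (fst.comp fst) (snd.comp (snd.comp fst)))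
  have hb : Computable fun x : α × Bool × T × T => fb x.2.1 x.2.2.1 x.2.2.2 := by
    have hx : Computable fun x : α × Bool × T × T => x.2.2.1 := fst.comp (snd.comp snd)
    have hy : Computable fun x : α × Bool × T × T => x.2.2.2 := snd.comp (snd.comp snd)
    exact cond (fst.comp snd) (hchoice.comp hx hy) (hseq.comp hx hy)
  have h := PTree.computable_fold (fl := fun _ : α => fl) (fu := fu) (fb := fun _ : α => fb)
    hl hu hb
  have hp : Computable fun x : α × Policy k n S => (x.1, x.2.toTree) :=
    pair fst (Policy.computable_toTree.comp snd)
  refine Computable₂.mk ((Computable.comp h hp).of_eq fun x => ?_)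
  obtain ⟨a, p⟩ := x
  induction p <;> simp_all [Policy.toTree, PTree.fold, Policy.fold, fl, fu, fb]

open OmegaCompletePartialOrder

/-! ### Sums as suprema -/

section Order

variable {S : Type u} [OmegaContinuousSemiring S]

instance : AddLeftMono S :=
  ⟨fun a _ _ h => (OmegaContinuousSemiring.add_continuous a).monotone h⟩

instance : MulLeftMono S :=
  ⟨fun a _ _ h => (OmegaContinuousSemiring.mul_left_continuous a).monotone h⟩

instance : MulRightMono S :=
  ⟨fun a _ _ h => (OmegaContinuousSemiring.mul_right_continuous a).monotone h⟩

/-- Addition of the semiring is the binary supremum. -/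
class AddIsSup (S : Type u) [OmegaContinuousSemiring S] : Prop where
  add_le_iff : ∀ a b c : S, a + b ≤ c ↔ a ≤ c ∧ b ≤ c

variable [AddIsSup S]

theorem add_le_iff {a b c : S} : a + b ≤ c ↔ a ≤ c ∧ b ≤ c := AddIsSup.add_le_iff a b c

theorem le_add_left' (a b : S) : a ≤ a + b := (add_le_iff.1 le_rfl).1

theorem le_add_right' (a b : S) : b ≤ a + b := (add_le_iff.1 le_rfl).2

theorem sum_le_iff {ι : Type*} {s : Finset ι} {f : ι → S} {r : S} :
    ∑ i ∈ s, f i ≤ r ↔ ∀ i ∈ s, f i ≤ r := by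
  classical
  induction s using Finset.induction_on with
  | empty => simp [OmegaContinuousSemiring.zero_least]
  | insert i s hi ih => rw [Finset.sum_insert hi, add_le_iff, ih, Finset.forall_mem_insert]

theorem mul_sum_mul_le_iff {ι : Type*} {s : Finset ι} {f : ι → S} {a b r : S} :
    a * (∑ i ∈ s, f i) * b ≤ r ↔ ∀ i ∈ s, a * f i * b ≤ r := by
  rw [Finset.mul_sum, Finset.sum_mul, sum_le_iff]

theorem mul_add_mul_le_iff {a b c d r : S} :
    a * (c + d) * b ≤ r ↔ a * c * b ≤ r ∧ a * d * b ≤ r := by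
  rw [mul_add, add_mul, add_le_iff]

/-- The map `x ↦ a * x * b` preserves suprema of chains, and a bound on all partial sums is a bound
on all terms. The two-sided context is what later inductions over composition require. -/
theorem mul_omegaSum_mul_le_iff {f : ℕ → S} {a b r : S} :
    a * omegaSum f * b ≤ r ↔ ∀ i, a * f i * b ≤ r := by
  have h : ωScottContinuous fun x : S => a * x * b :=
    (OmegaContinuousSemiring.mul_right_continuous b).comp
      (OmegaContinuousSemiring.mul_left_continuous a)
  have h' : a * omegaSum f * b = _ := h.map_ωSup _
  rw [h', ωSup_le_iff]
  change (∀ i, a * (∑ j ∈ Finset.range i, f j) * b ≤ r) ↔ _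
  simp only [mul_sum_mul_le_iff, Finset.mem_range]
  -- The partial sum over `range (i + 1)` is the first to contain the term `i`.
  exact ⟨fun H i => H (i + 1) i i.lt_succ_self, fun H _ i _ => H i⟩

theorem omegaSum_le_iff {f : ℕ → S} {r : S} : omegaSum f ≤ r ↔ ∀ i, f i ≤ r := by
  simpa using mul_omegaSum_mul_le_iff (f := f) (a := 1) (b := 1) (r := r)

theorem le_omegaSum (f : ℕ → S) (i : ℕ) : f i ≤ omegaSum f := omegaSum_le_iff.1 le_rfl i

/-- Indices that enumerate nothing contribute `0`, which is below every `r`. -/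
theorem mul_countableSum_mul_le_iff {I : Type v} [Encodable I] {f : I → S} {a b r : S} :
    a * countableSum f * b ≤ r ↔ ∀ i, a * f i * b ≤ r := by
  rw [countableSum, mul_omegaSum_mul_le_iff]
  refine ⟨fun H i => by simpa using H (Encodable.encode i), fun H m => ?_⟩
  cases Encodable.decode (α := I) m with
  | none => simpa using OmegaContinuousSemiring.zero_least r
  | some i => exact H i

theorem le_countableSum {I : Type v} [Encodable I] (f : I → S) (i : I) : f i ≤ countableSum f := by
  simpa using (mul_countableSum_mul_le_iff (f := f) (a := 1) (b := 1)).1 le_rfl i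

theorem mul_closure_mul_le_iff {s a b r : S} :
    a * closure s * b ≤ r ↔ ∀ i, a * s ^ i * b ≤ r :=
  mul_omegaSum_mul_le_iff

theorem pow_le_closure (s : S) (i : ℕ) : s ^ i ≤ closure s := le_omegaSum _ i

theorem one_le_closure (s : S) : 1 ≤ closure s := by simpa using pow_le_closure s 0

/-- Both factors expand into powers, and `s ^ i * s ^ j = s ^ (i + j)` is again a term of the
closure. -/
theorem closure_mul_closure_le (s : S) : closure s * closure s ≤ closure s := by
  have h : 1 * closure s * closure s ≤ closure s := by
    refine mul_closure_mul_le_iff.2 fun i => ?_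
    have h : 1 * s ^ i * closure s * 1 ≤ closure s := by
      refine mul_closure_mul_le_iff.2 fun j => ?_
      simpa [pow_add] using pow_le_closure s (i + j)
    simpa using h
  simpa using h

theorem le_closure (s : S) : s ≤ closure s := by simpa using pow_le_closure s 1

/-- Induction gives `s ^ i ≤ s ^ i * t ≤ t` for every `i`. -/
theorem closure_le {s t : S} (h1 : 1 ≤ t) (hs : s * t ≤ t) : closure s ≤ t := by
  refine omegaSum_le_iff.2 fun i => ?_
  suffices s ^ i * t ≤ t from (le_mul_of_one_le_right' h1).trans this
  induction i with
  | zero => simp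
  | succ i ih => rw [pow_succ', mul_assoc]; exact (mul_le_mul_right ih s).trans hs

end Order

/-! ### The closure of a matrix -/

section Matrix

variable {S : Type u} [OmegaContinuousSemiring S] {I : Type v}

/-- One pivot step of the Floyd–Warshall–Kleene algorithm. -/
def pivot (k : I) (A : Matrix I I S) : Matrix I I S :=
  Matrix.of fun i j => A i j + A i k * closure (A k k) * A k j

/-- The transitive closure of a matrix, after pivoting at the indices in `l`. -/
def pivots (l : List I) (A : Matrix I I S) : Matrix I I S :=
  l.foldl (fun A k => pivot k A) A

variable [AddIsSup S]

theorem le_pivot (k : I) (A : Matrix I I S) (i j : I) : A i j ≤ pivot k A i j :=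
  le_add_left' _ _

/-- With `c = closure (A k k)`, the new column entry is at most `A i k * c` and the new row entry at
most `c * A k j`; the factors `c` merge because `c * c ≤ c`. -/
theorem mul_le_pivot_self (k : I) (A : Matrix I I S) (i j : I) :
    pivot k A i k * pivot k A k j ≤ pivot k A i j := by
  have hl : pivot k A i k ≤ A i k * closure (A k k) := by
    refine add_le_iff.2 ⟨le_mul_of_one_le_right' (one_le_closure _), ?_⟩
    rw [mul_assoc]
    exact mul_le_mul_right ((mul_le_mul_right (le_closure _) _).trans (closure_mul_closure_le _)) _
  have hr : pivot k A k j ≤ closure (A k k) * A k j := by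
    refine add_le_iff.2 ⟨le_mul_of_one_le_left' (one_le_closure _), ?_⟩
    exact mul_le_mul_left ((mul_le_mul_left (le_closure _) _).trans (closure_mul_closure_le _)) _
  refine (mul_le_mul' hl hr).trans (le_trans (le_of_eq ?_) ((mul_le_mul_left (mul_le_mul_right
    (closure_mul_closure_le (A k k)) (A i k)) (A k j)).trans (le_add_right' _ _)))
  simp only [mul_assoc]

/-- Transitivity through `k` survives a pivot at `m`. Each factor is either an old entry or a detour
through `m`; in each of the four products the passage through `k` is shortcut by `h`, and a
resulting loop at `m` is absorbed by the closure. -/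
theorem mul_le_pivot {k : I} {A : Matrix I I S} (h : ∀ i j, A i k * A k j ≤ A i j) (m i j : I) :
    pivot m A i k * pivot m A k j ≤ pivot m A i j := by
  simp only [pivot, Matrix.of_apply, add_mul, mul_add, add_le_iff]
  set s := A m m
  have hs : closure s * s * closure s ≤ closure s :=
    (mul_le_mul_left ((mul_le_mul_right (le_closure _) _).trans (closure_mul_closure_le _))
      _).trans (closure_mul_closure_le _)
  refine ⟨⟨(h i j).trans (le_add_left' _ _), le_trans ?_ (le_add_right' _ _)⟩,
    le_trans ?_ (le_add_right' _ _), le_trans ?_ (le_add_right' _ _)⟩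
  · calc A i m * closure s * A m k * A k j = A i m * closure s * (A m k * A k j) := by
          simp only [mul_assoc]
      _ ≤ _ := mul_le_mul_right (h m j) _
  · calc A i k * (A k m * closure s * A m j) = A i k * A k m * (closure s * A m j) := by
          simp only [mul_assoc]
      _ ≤ A i m * (closure s * A m j) := mul_le_mul_left (h i m) _
      _ = _ := by simp only [mul_assoc]
  · calc A i m * closure s * A m k * (A k m * closure s * A m j)
        = A i m * closure s * (A m k * A k m) * (closure s * A m j) := by simp only [mul_assoc]
      _ ≤ A i m * closure s * s * (closure s * A m j) :=
          mul_le_mul_left (mul_le_mul_right (h m m) _) _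
      _ = A i m * (closure s * s * closure s) * A m j := by simp only [mul_assoc]
      _ ≤ _ := mul_le_mul_left (mul_le_mul_right hs _) _

theorem le_pivots (l : List I) (A : Matrix I I S) (i j : I) : A i j ≤ pivots l A i j := by
  induction l generalizing A with
  | nil => exact le_rfl
  | cons k l ih => exact (le_pivot k A i j).trans (ih _)

theorem mul_le_pivots_of_trans {k : I} {A : Matrix I I S} (h : ∀ i j, A i k * A k j ≤ A i j)
    (l : List I) (i j : I) : pivots l A i k * pivots l A k j ≤ pivots l A i j := by
  induction l generalizing A with
  | nil => exact h i j
  | cons m l ih => exact ih (mul_le_pivot h m)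

theorem mul_le_pivots {l : List I} {k : I} (hk : k ∈ l) (A : Matrix I I S) (i j : I) :
    pivots l A i k * pivots l A k j ≤ pivots l A i j := by
  induction l generalizing A with
  | nil => simp at hk
  | cons m l ih =>
    by_cases h : k ∈ l
    · exact ih h _
    · obtain rfl : k = m := by simpa [h] using hk
      exact mul_le_pivots_of_trans (mul_le_pivot_self k A) l i j

/-- A reflexive and transitive `T` above `A` stays above every pivot: by `closure_le` it dominates
the closure of the pivot entry, and transitivity then collapses the detour. -/
theorem pivots_le {A T : Matrix I I S} (h1 : ∀ i, 1 ≤ T i i)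
    (hT : ∀ i j k, T i k * T k j ≤ T i j) (hA : ∀ i j, A i j ≤ T i j) (l : List I) (i j : I) :
    pivots l A i j ≤ T i j := by
  induction l generalizing A with
  | nil => exact hA i j
  | cons k l ih =>
    refine ih fun i j => add_le_iff.2 ⟨hA i j, ?_⟩
    have hc : closure (A k k) ≤ T k k :=
      closure_le (h1 k) ((mul_le_mul_left (hA k k) _).trans (hT k k k))
    exact (mul_le_mul' (mul_le_mul' (hA i k) hc) (hA k j)).trans
      ((mul_le_mul_left (hT i k k) _).trans (hT i j k))

variable [Fintype I] [DecidableEq I]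

/-- The reflexive and transitive closure of a matrix, computed by pivoting at all indices. -/
noncomputable def matrixClosure (A : Matrix I I S) : Matrix I I S :=
  1 + pivots Finset.univ.toList A

theorem pow_le_matrixClosure (A : Matrix I I S) (m : ℕ) (i j : I) :
    (A ^ m) i j ≤ matrixClosure A i j := by
  induction m generalizing i with
  | zero => rw [pow_zero]; exact le_add_left' _ _
  | succ m ih =>
    rw [pow_succ', Matrix.mul_apply]
    refine sum_le_iff.2 fun k _ => ?_
    refine (mul_le_mul' (le_pivots Finset.univ.toList A i k) (ih k)).trans ?_
    rw [matrixClosure, Matrix.add_apply, mul_add, add_le_iff]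
    constructor
    · rw [Matrix.one_apply]
      split_ifs with h
      · subst h; simpa using le_add_right' _ _
      · simpa using OmegaContinuousSemiring.zero_least _
    · exact (mul_le_pivots (by simp) A i j).trans (le_add_right' _ _)

/-- The entrywise sum of all powers is reflexive, transitive and above `A`, so it dominates the
pivoted matrix. Conversely, each power is below the closure, which is transitive because every index
has served as pivot. -/
theorem matrixClosure_eq_omegaSum (A : Matrix I I S) (i j : I) :
    matrixClosure A i j = omegaSum fun m => (A ^ m) i j := by
  apply le_antisymm
  · let T : Matrix I I S := Matrix.of fun i j => omegaSum fun m => (A ^ m) i j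
    have hpow : ∀ m i j, (A ^ m) i j ≤ T i j := fun m i j => le_omegaSum (fun m => (A ^ m) i j) m
    have h1 : ∀ i, 1 ≤ T i i := fun i => by simpa using hpow 0 i i
    have hT : ∀ i j k, T i k * T k j ≤ T i j := by
      intro i j k
      suffices 1 * T i k * T k j ≤ T i j by simpa using this
      refine mul_omegaSum_mul_le_iff.2 fun m => ?_
      suffices 1 * (A ^ m) i k * T k j * 1 ≤ T i j by simpa using this
      refine mul_omegaSum_mul_le_iff.2 fun m' => ?_
      have h := hpow (m + m') i j
      rw [pow_add, Matrix.mul_apply, sum_le_iff] at h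
      simpa using h k (Finset.mem_univ k)
    have h0 : (1 : Matrix I I S) i j ≤ T i j := by simpa using hpow 0 i j
    refine add_le_iff.2 ⟨h0, ?_⟩
    exact pivots_le h1 hT (fun i j => by simpa using hpow 1 i j) _ i j
  · exact omegaSum_le_iff.2 fun m => pow_le_matrixClosure A m i j

end Matrix

/-! ### The packet matrix of a policy -/

section PacketMatrix

variable {S : Type u} [OmegaContinuousSemiring S] {k n : ℕ}

/-- The matrix of a policy: the weight with which an input packet is turned into the head packet
of an output history, whatever the tail of the latter is. -/
noncomputable def Policy.packetMatrix [AddIsSup S] :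
    Policy k n S → Matrix (Packet k n) (Packet k n) S :=
  Policy.fold (fun t => Matrix.of fun π π' => if t.eval π && decide (π = π') then 1 else 0)
    (fun f v => Matrix.of fun π π' => if Function.update π f v = π' then 1 else 0) 1
    (fun A B => A * B) (fun s A => s • A) (fun A B => A + B) matrixClosure

/-- At most one tail carries a nonzero weight; for the others the bound holds because `0` is least.
-/
theorem mul_eta_mul_le_iff {h : History k n} {π : Packet k n} {c a b r : S} :
    (∀ t, a * (c * eta h (π, t)) * b ≤ r) ↔ a * (c * if h.1 = π then 1 else 0) * b ≤ r := by
  obtain ⟨π', t'⟩ := h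
  by_cases hπ : π' = π
  · subst hπ
    refine ⟨fun H => by simpa [eta] using H t', fun H t => ?_⟩
    by_cases ht : t' = t
    · simpa [eta, ht] using H
    · simpa [eta, ht] using OmegaContinuousSemiring.zero_least r
  · simp [eta, hπ]

variable [AddIsSup S]

/-- Composition becomes matrix product because the bound for `g` sees only the head of the
intermediate history. The left context of `hg` absorbs the weight of `f`, and the right context of
`hf` absorbs the matrix entry of `g`. -/
theorem mul_bind_mul_le_iff {f : History k n → S} {g : History k n → History k n → S}
    {A : Packet k n → S} {B : Matrix (Packet k n) (Packet k n) S}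
    (hf : ∀ π (a b r : S), (∀ t, a * f (π, t) * b ≤ r) ↔ a * A π * b ≤ r)
    (hg : ∀ h π (a b r : S), (∀ t, a * g h (π, t) * b ≤ r) ↔ a * B h.1 π * b ≤ r)
    (π : Packet k n) (a b r : S) :
    (∀ t, a * bind f g (π, t) * b ≤ r) ↔ a * (∑ π', A π' * B π' π) * b ≤ r := by
  simp only [bind, mul_countableSum_mul_le_iff, mul_sum_mul_le_iff, Finset.mem_univ, true_imp_iff]
  rw [forall_comm, Prod.forall]
  refine forall_congr' fun π' => ?_
  have h := hf π' a (B π' π * b) r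
  simp only [← mul_assoc] at h ⊢
  rw [← h]
  exact forall_congr' fun t' => by simpa only [mul_assoc] using hg (π', t') π (a * f (π', t')) b r

/-- The matrix entry acts as the supremum over output tails, described through its upper bounds. The
contexts `a` and `b` make the statement strong enough for induction, and the tail of `h` does not
matter. -/
theorem Policy.mul_sem_mul_le_iff (p : Policy k n S) (h : History k n) (π : Packet k n)
    (a b r : S) :
    (∀ t, a * p.sem h (π, t) * b ≤ r) ↔ a * p.packetMatrix h.1 π * b ≤ r := by
  induction p generalizing h π a b r with
  | filter t =>
    simp only [sem, mul_eta_mul_le_iff, packetMatrix, fold, Matrix.of_apply]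
    cases t.eval h.1 <;> simp
  | modify f v =>
    simpa [sem, packetMatrix, fold] using mul_eta_mul_le_iff
      (h := (Function.update h.1 f v, h.2)) (π := π) (c := 1) (a := a) (b := b) (r := r)
  | dup =>
    simpa [sem, packetMatrix, fold, Matrix.one_apply] using mul_eta_mul_le_iff
      (h := (h.1, h.1 :: h.2)) (π := π) (c := 1) (a := a) (b := b) (r := r)
  | seq p q ihp ihq =>
    exact mul_bind_mul_le_iff (fun π => ihp h π) ihq π a b r
  | weight s p ih => simpa [sem, packetMatrix, fold, mul_assoc] using ih h π (a * s) b r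
  | choice p q ihp ihq =>
    simp only [sem, mul_add_mul_le_iff, forall_and, ihp, ihq]
    exact mul_add_mul_le_iff.symm
  | iter p ih =>
    -- Each semantic iterate corresponds to a matrix power; the closure then collects all powers.
    have hi : ∀ (i : ℕ) (h : History k n) (π : Packet k n) (a b r : S),
        (∀ t, a * iterate p.sem i h (π, t) * b ≤ r) ↔
          a * (p.packetMatrix ^ i) h.1 π * b ≤ r := by
      intro i
      induction i with
      | zero =>
        intro h π a b r
        simpa [iterate, Matrix.one_apply] using
          mul_eta_mul_le_iff (h := h) (π := π) (c := 1) (a := a) (b := b) (r := r)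
      | succ i ihi =>
        intro h π a b r
        rw [pow_succ', Matrix.mul_apply]
        exact mul_bind_mul_le_iff (fun π => ih h π) ihi π a b r
    have hc : (iter p).packetMatrix h.1 π = matrixClosure p.packetMatrix h.1 π := rfl
    simp only [sem, hc, matrixClosure_eq_omegaSum, mul_omegaSum_mul_le_iff]
    rw [forall_comm]
    exact forall_congr' fun i => hi i h π a b r

theorem Policy.safe_iff (p : Policy k n S) (r : S) :
    p.Safe r ↔ ∀ π π', p.packetMatrix π π' ≤ r := by
  refine forall_congr' fun π => ?_
  rw [Prod.forall]
  exact forall_congr' fun π' => by simpa using p.mul_sem_mul_le_iff (π, []) π' 1 1 r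

end PacketMatrix

/-! ### Computability of the packet matrix -/

section MatrixComputability

variable {S : Type u} {I : Type v} {J : Type w} [Fintype I] [Fintype J]

/-- A matrix as the list of its entries. -/
noncomputable def matrixEquiv : Matrix I J S ≃ (Fin (Fintype.card (I × J)) → S) :=
  Matrix.of.symm.trans ((Equiv.curry I J S).symm.trans
    ((Fintype.equivFin (I × J)).arrowCongr (Equiv.refl S)))

variable [Primcodable S]

noncomputable instance : Primcodable (Matrix I J S) :=
  Primcodable.ofEquiv _ matrixEquiv

theorem computable_matrix_apply (i : I) (j : J) : Computable fun A : Matrix I J S => A i j := by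
  have h : Computable fun A : Matrix I J S => matrixEquiv A (Fintype.equivFin (I × J) (i, j)) :=
    Computable.fin_app.comp (Primrec.of_equiv (e := matrixEquiv)).to_comp (Computable.const _)
  exact h.of_eq fun A => by simp [matrixEquiv]

/-- There are finitely many entries, so no uniformity in the indices is needed. -/
theorem computable_matrix {α : Type*} [Primcodable α] {f : α → Matrix I J S}
    (hf : ∀ i j, Computable fun a => f a i j) : Computable f := by
  have hv : Computable fun a => List.Vector.ofFn fun m =>
      f a ((Fintype.equivFin (I × J)).symm m).1 ((Fintype.equivFin (I × J)).symm m).2 :=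
    Computable.vector_ofFn fun m => hf _ _
  have hg : Computable fun x : List.Vector S (Fintype.card (I × J)) => x.get :=
    (Primrec.fin_curry.2 Primrec.vector_get).to_comp
  refine ((Primrec.of_equiv_symm (e := matrixEquiv)).to_comp.comp (hg.comp hv)).of_eq fun a => ?_
  rw [Equiv.symm_apply_eq]
  funext m
  simp [matrixEquiv, Function.uncurry]

end MatrixComputability

section PacketMatrixComputability

open Computable

variable {S : Type u} [OmegaContinuousSemiring S] [Primcodable S] [ComputableSemiring S]
  {I : Type v}

theorem computable_pivot [Fintype I] (k : I) :
    Computable (pivot k : Matrix I I S → Matrix I I S) :=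
  computable_matrix fun i j => ComputableSemiring.computable_add.comp (computable_matrix_apply i j)
    (ComputableSemiring.computable_mul.comp
      (ComputableSemiring.computable_mul.comp (computable_matrix_apply i k)
        (ComputableSemiring.computable_closure.comp (computable_matrix_apply k k)))
      (computable_matrix_apply k j))

theorem computable_pivots [Fintype I] (l : List I) :
    Computable (pivots l : Matrix I I S → Matrix I I S) := by
  induction l with
  | nil => exact Computable.id
  | cons k l ih => exact ih.comp (computable_pivot k)

theorem computable_matrixClosure [Fintype I] [DecidableEq I] :
    Computable (matrixClosure : Matrix I I S → Matrix I I S) :=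
  computable_matrix fun i j => ComputableSemiring.computable_add.comp
    (const ((1 : Matrix I I S) i j))
    ((computable_matrix_apply i j).comp (computable_pivots Finset.univ.toList))

theorem computable_matrix_add [Fintype I] :
    Computable₂ fun A B : Matrix I I S => A + B :=
  Computable₂.mk (computable_matrix fun i j => ComputableSemiring.computable_add.comp
    ((computable_matrix_apply i j).comp fst) ((computable_matrix_apply i j).comp snd))

theorem computable_matrix_smul [Fintype I] :
    Computable₂ fun (s : S) (A : Matrix I I S) => s • A :=
  Computable₂.mk (computable_matrix fun i j => ComputableSemiring.computable_mul.comp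
    fst ((computable_matrix_apply i j).comp snd))

theorem computable_matrix_mul [Fintype I] :
    Computable₂ fun A B : Matrix I I S => A * B := by
  refine Computable₂.mk (computable_matrix fun i j => ?_)
  simp only [Matrix.mul_apply]
  exact computable_finset_sum ComputableSemiring.computable_add _ fun m =>
    ComputableSemiring.computable_mul.comp
      ((computable_matrix_apply i m).comp fst) ((computable_matrix_apply m j).comp snd)

variable {k n : ℕ}

theorem Policy.computable_packetMatrix [AddIsSup S] :
    Computable (Policy.packetMatrix : Policy k n S → Matrix (Packet k n) (Packet k n) S) := by
  have hfilter : Computable fun t : Pred k n => (Matrix.of fun π π' =>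
      if t.eval π && decide (π = π') then 1 else 0 : Matrix (Packet k n) (Packet k n) S) := by
    refine computable_matrix fun π π' => computable_ite ?_ (const 1) (const 0)
    have h : Computable fun t : Pred k n => t.eval π :=
      Pred.computable_eval.comp Computable.id (const π)
    exact (Primrec.and.to_comp.comp h (const (decide (π = π')))).of_eq fun t => by simp
  have h := Policy.computable_fold (α := Unit) (fiter := fun _ => matrixClosure)
    (fmodify := fun f v => Matrix.of fun π π' => if Function.update π f v = π' then 1 else 0)
    (fdup := 1) hfilter computable_matrix_mul computable_matrix_smul computable_matrix_add
    (Computable₂.mk (computable_matrixClosure.comp snd))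
  exact h.comp (const ()) Computable.id

/-- Safety is decidable. -/
theorem computablePred_safe [AddIsSup S] :
    ComputablePred fun x : Policy k n S × S => x.1.Safe x.2 := by
  obtain ⟨_, hle⟩ := ComputableSemiring.decidable_le (S := S)
  classical
  refine ⟨Classical.decPred _, ?_⟩
  have h : Computable fun x : Policy k n S × S =>
      (Finset.univ : Finset (Packet k n)).toList.all fun π =>
        (Finset.univ : Finset (Packet k n)).toList.all fun π' =>
          decide (x.1.packetMatrix π π' ≤ x.2) := by
    refine computable_list_all _ fun π => computable_list_all _ fun π' => ?_
    have hp : Computable fun x : Policy k n S × S => (x.1.packetMatrix π π', x.2) :=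
      pair ((computable_matrix_apply π π').comp (Policy.computable_packetMatrix.comp fst)) snd
    exact (Computable.comp hle hp).of_eq fun x => by simp
  refine h.of_eq fun x => ?_
  rw [Bool.eq_iff_iff]
  simp [Policy.safe_iff]

end PacketMatrixComputability

/-! ### Runs of a policy -/

/-- A run: an input packet, a weight, and the packets that are put in place of the input packet
when the run is executed. -/
abbrev Run (k n : ℕ) (S : Type u) := Packet k n × S × History k n

section Runs

variable {S : Type u} [OmegaContinuousSemiring S] {k n : ℕ}

/-- The sequential compositions of runs in `l` with runs in `l'`. -/
def runComp (l l' : List (Run k n S)) : List (Run k n S) :=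
  l.flatMap fun x => l'.flatMap fun y =>
    if x.2.2.1 = y.1 then [(x.1, x.2.1 * y.2.1, y.2.2.1, y.2.2.2 ++ x.2.2.2)] else []

/-- The runs that do nothing. -/
noncomputable def runSkip : List (Run k n S) :=
  Finset.univ.toList.map fun π => (π, 1, π, [])

/-- The compositions of at most `m` runs in `l`. -/
noncomputable def runIter (m : ℕ) (l : List (Run k n S)) : List (Run k n S) :=
  m.rec runSkip fun _ l' => runSkip ++ runComp l l'

/-- The runs of a policy in which every iteration is unrolled at most `m` times. -/
noncomputable def Policy.runs (m : ℕ) : Policy k n S → List (Run k n S) :=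
  Policy.fold
    (fun t => Finset.univ.toList.flatMap fun π => if t.eval π then [(π, 1, π, [])] else [])
    (fun f v => Finset.univ.toList.map fun π => (π, 1, Function.update π f v, []))
    (Finset.univ.toList.map fun π => (π, 1, π, [π]))
    runComp (fun s l => l.map fun x => (x.1, s * x.2.1, x.2.2)) (fun l l' => l ++ l') (runIter m)

/-- The second run starts at the packet where the first one ends. Histories grow at the front, so
its packets precede those left by the first. -/
theorem mem_runComp {l l' : List (Run k n S)} {z : Run k n S} :
    z ∈ runComp l l' ↔ ∃ x ∈ l, ∃ y ∈ l', x.2.2.1 = y.1 ∧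
      z = (x.1, x.2.1 * y.2.1, y.2.2.1, y.2.2.2 ++ x.2.2.2) := by
  simp only [runComp, List.mem_flatMap]
  refine exists_congr fun x => and_congr_right fun _ => exists_congr fun y =>
    and_congr_right fun _ => ?_
  split_ifs with h <;> simp [h]

theorem runComp_subset {l₁ l₂ l₁' l₂' : List (Run k n S)} (h : l₁ ⊆ l₂) (h' : l₁' ⊆ l₂') :
    runComp l₁ l₁' ⊆ runComp l₂ l₂' := by
  intro z hz
  obtain ⟨x, hx, y, hy, hz⟩ := mem_runComp.1 hz
  exact mem_runComp.2 ⟨x, h hx, y, h' hy, hz⟩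

theorem runSkip_subset_runIter (m : ℕ) (l : List (Run k n S)) : runSkip ⊆ runIter m l := by
  cases m with
  | zero => exact fun _ h => h
  | succ m => exact List.subset_append_left _ _

theorem runIter_subset {m m' : ℕ} (hm : m ≤ m') {l l' : List (Run k n S)} (h : l ⊆ l') :
    runIter m l ⊆ runIter m' l' := by
  induction m generalizing m' with
  | zero => exact runSkip_subset_runIter m' l'
  | succ m ih =>
    obtain ⟨m', rfl⟩ : ∃ j, m' = j + 1 := ⟨m' - 1, by omega⟩
    exact List.append_subset.2 ⟨List.subset_append_left _ _,
      List.subset_append_of_subset_right _ (runComp_subset h (ih (Nat.le_of_succ_le_succ hm)))⟩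

/-- Monotonicity lets runs found with different unrolling bounds be combined under the larger bound.
-/
theorem Policy.runs_subset {m m' : ℕ} (hm : m ≤ m') (p : Policy k n S) :
    p.runs m ⊆ p.runs m' := by
  induction p with
  | filter t => exact fun _ h => h
  | modify f v => exact fun _ h => h
  | dup => exact fun _ h => h
  | seq p q ihp ihq => exact runComp_subset ihp ihq
  | weight s p ih => exact List.map_subset _ ih
  | choice p q ihp ihq =>
    exact List.append_subset.2 ⟨List.subset_append_of_subset_left _ ihp,
      List.subset_append_of_subset_right _ ihq⟩
  | iter p ih => exact runIter_subset hm ih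

/-- Every run in `l` contributes its weight to the semantic function `f`. -/
def RunsSound (l : List (Run k n S)) (f : History k n → History k n → S) : Prop :=
  ∀ x ∈ l, ∀ t, x.2.1 ≤ f (x.1, t) (x.2.2.1, x.2.2.2 ++ t)

/-- The semantic function `f` is bounded, in every context, by the runs in the lists `L m`. -/
def RunsComplete (L : ℕ → List (Run k n S)) (f : History k n → History k n → S) : Prop :=
  ∀ h h' (a b r : S), (∀ m, ∀ x ∈ L m, x.1 = h.1 → x.2.2.1 = h'.1 → a * x.2.1 * b ≤ r) →
    a * f h h' * b ≤ r

variable [AddIsSup S]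

/-- The product of the two weights is below a single summand of the bind, the one at the history
left by the first run. -/
theorem RunsSound.comp {l l' : List (Run k n S)} {f g : History k n → History k n → S}
    (hl : RunsSound l f) (hl' : RunsSound l' g) :
    RunsSound (runComp l l') fun h => bind (f h) g := by
  intro z hz t
  obtain ⟨x, hx, y, hy, hxy, rfl⟩ := mem_runComp.1 hz
  have h1 := hl x hx t
  have h2 := hl' y hy (x.2.2.2 ++ t)
  rw [← hxy] at h2
  refine (mul_le_mul' h1 h2).trans ?_
  simpa [bind] using le_countableSum
    (fun h => f (x.1, t) h * g h (y.2.2.1, y.2.2.2 ++ x.2.2.2 ++ t)) (x.2.2.1, x.2.2.2 ++ t)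

theorem RunsSound.iter {l : List (Run k n S)} {f : History k n → History k n → S}
    (hl : RunsSound l f) (m : ℕ) :
    RunsSound (runIter m l) fun h h' => omegaSum fun i => iterate f i h h' := by
  have hskip : RunsSound (runSkip : List (Run k n S))
      fun h h' => omegaSum fun i => iterate f i h h' := by
    intro x hx t
    obtain ⟨π, -, rfl⟩ := List.mem_map.1 hx
    simpa [iterate, eta] using le_omegaSum (fun i => iterate f i (π, t) (π, t)) 0
  induction m with
  | zero => exact hskip
  | succ m ih =>
    intro x hx t
    rcases List.mem_append.1 hx with hx | hx
    · exact hskip x hx t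
    · refine (hl.comp ih x hx t).trans ?_
      -- Composing `f` with the sum of its iterates stays below that sum: the term `i` becomes a
      -- part of the iterate `i + 1`.
      suffices H : ∀ h h', 1 * bind (f h) (fun h h' => omegaSum fun i => iterate f i h h') h' * 1 ≤
          omegaSum fun i => iterate f i h h' by simpa using H _ _
      refine fun h h' => mul_countableSum_mul_le_iff.2 fun h'' => ?_
      rw [← mul_assoc]
      refine mul_omegaSum_mul_le_iff.2 fun i => le_trans ?_
        (le_omegaSum (fun i => iterate f i h h') (i + 1))
      simpa [iterate, bind] using le_countableSum (fun h'' => f h h'' * iterate f i h'' h') h''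

theorem Policy.runs_sound (m : ℕ) (p : Policy k n S) : RunsSound (p.runs m) p.sem := by
  induction p with
  | filter t =>
    intro x hx s
    obtain ⟨π, -, hx⟩ := List.mem_flatMap.1 hx
    by_cases h : t.eval π
    · simp only [h, if_true, List.mem_singleton] at hx
      subst hx
      simp [sem, eta, h]
    · simp [h] at hx
  | modify f v =>
    intro x hx s
    obtain ⟨π, -, rfl⟩ := List.mem_map.1 hx
    simp [sem, eta]
  | dup =>
    intro x hx s
    obtain ⟨π, -, rfl⟩ := List.mem_map.1 hx
    simp [sem, eta]
  | seq p q ihp ihq => exact ihp.comp ihq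
  | weight s p ih =>
    intro x hx t
    obtain ⟨y, hy, rfl⟩ := List.mem_map.1 hx
    exact mul_le_mul_right (ih y hy t) s
  | choice p q ihp ihq =>
    intro x hx t
    rcases List.mem_append.1 hx with hx | hx
    · exact (ihp x hx t).trans (le_add_left' _ _)
    · exact (ihq x hx t).trans (le_add_right' _ _)
  | iter p ih => exact ih.iter m

theorem RunsComplete.comp {L L' : ℕ → List (Run k n S)} {f g : History k n → History k n → S}
    (hL : RunsComplete L f) (hL' : RunsComplete L' g) (hm : ∀ i j, i ≤ j → L i ⊆ L j)
    (hm' : ∀ i j, i ≤ j → L' i ⊆ L' j) :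
    RunsComplete (fun m => runComp (L m) (L' m)) fun h => bind (f h) g := by
  intro h h' a b r H
  refine mul_countableSum_mul_le_iff.2 fun h'' => ?_
  suffices a * f h h'' * (g h'' h' * b) ≤ r by simpa only [mul_assoc] using this
  refine hL h h'' a _ r fun i x hx hx1 hx2 => ?_
  rw [← mul_assoc]
  refine hL' h'' h' _ b r fun j y hy hy1 hy2 => ?_
  rw [mul_assoc a]
  -- The two runs come from the separate bounds `i` and `j`; both occur at the maximum.
  exact H (max i j) (x.1, x.2.1 * y.2.1, y.2.2.1, y.2.2.2 ++ x.2.2.2)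
    (mem_runComp.2 ⟨x, hm i _ (le_max_left i j) hx, y, hm' j _ (le_max_right i j) hy,
      hx2.trans hy1.symm, rfl⟩) hx1 hy2

theorem RunsComplete.iter {L : ℕ → List (Run k n S)} {f : History k n → History k n → S}
    (hL : RunsComplete L f) (hm : ∀ i j, i ≤ j → L i ⊆ L j) :
    RunsComplete (fun m => runIter m (L m)) fun h h' => omegaSum fun i => iterate f i h h' := by
  have hi : ∀ i, RunsComplete (fun m => runIter m (L m)) (iterate f i) := by
    intro i
    induction i with
    | zero =>
      intro h h' a b r H
      by_cases hh : h = h'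
      · subst hh
        simpa [iterate, eta] using
          H 0 (h.1, 1, h.1, []) (List.mem_map.2 ⟨h.1, by simp, rfl⟩) rfl rfl
      · simpa [iterate, eta, hh] using OmegaContinuousSemiring.zero_least r
    | succ i ih =>
      intro h h' a b r H
      refine hL.comp ih hm (fun i j hij => runIter_subset hij (hm i j hij)) h h' a b r
        -- Prefixing one more run of the body uses one more unrolling, hence the bound `m + 1`.
        fun m x hx => H (m + 1) x (List.mem_append_right _ ?_)
      exact runComp_subset (hm _ _ m.le_succ) (runIter_subset le_rfl (hm _ _ m.le_succ)) hx
  exact fun h h' a b r H => mul_omegaSum_mul_le_iff.2 fun i => hi i h h' a b r H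

/-- Runs are matched with `h` and `h'` by head packets only. This suffices for bounds, since
soundness attaches to an offending run the history that the run itself produces. -/
theorem Policy.runs_complete (p : Policy k n S) : RunsComplete (fun m => p.runs m) p.sem := by
  induction p with
  | filter t =>
    intro h h' a b r H
    by_cases hh : t.eval h.1 = true ∧ h = h'
    · obtain ⟨ht, rfl⟩ := hh
      simpa [sem, eta, ht] using H 0 (h.1, 1, h.1, [])
        (List.mem_flatMap.2 ⟨h.1, by simp, by simp [ht]⟩) rfl rfl
    · have h0 : (filter t).sem h h' = (0 : S) := by
        rw [not_and_or] at hh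
        rcases hh with hh | hh <;> simp [sem, eta, hh]
      simpa [h0] using OmegaContinuousSemiring.zero_least r
  | modify f v =>
    intro h h' a b r H
    by_cases hh : (Function.update h.1 f v, h.2) = h'
    · subst hh
      simpa [sem, eta] using H 0 (h.1, 1, Function.update h.1 f v, [])
        (List.mem_map.2 ⟨h.1, by simp, rfl⟩) rfl rfl
    · simpa [sem, eta, hh] using OmegaContinuousSemiring.zero_least r
  | dup =>
    intro h h' a b r H
    by_cases hh : (h.1, h.1 :: h.2) = h'
    · subst hh
      simpa [sem, eta] using H 0 (h.1, 1, h.1, [h.1])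
        (List.mem_map.2 ⟨h.1, by simp, rfl⟩) rfl rfl
    · simpa [sem, eta, hh] using OmegaContinuousSemiring.zero_least r
  | seq p q ihp ihq =>
    exact ihp.comp ihq (fun _ _ hij => p.runs_subset hij) fun _ _ hij => q.runs_subset hij
  | weight s p ih =>
    intro h h' a b r H
    suffices a * s * p.sem h h' * b ≤ r by simpa [sem, mul_assoc] using this
    refine ih h h' (a * s) b r fun m x hx h1 h2 => ?_
    simpa only [mul_assoc] using H m (x.1, s * x.2.1, x.2.2) (List.mem_map.2 ⟨x, hx, rfl⟩) h1 h2
  | choice p q ihp ihq =>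
    intro h h' a b r H
    exact mul_add_mul_le_iff.2
      ⟨ihp h h' a b r fun m x hx => H m x (List.mem_append_left _ hx),
        ihq h h' a b r fun m x hx => H m x (List.mem_append_right _ hx)⟩
  | iter p ih => exact ih.iter fun _ _ hij => p.runs_subset hij

theorem Policy.exists_run_of_not_safe {p : Policy k n S} {r : S} (hp : ¬ p.Safe r) :
    ∃ m, ∃ x ∈ p.runs m, ¬ x.2.1 ≤ r := by
  by_contra! H
  refine hp fun π h => ?_
  simpa using p.runs_complete (π, []) h 1 1 r fun m x hx _ _ => by simpa using H m x hx

theorem Policy.not_sem_le_of_run {p : Policy k n S} {r : S} {m : ℕ} {x : Run k n S}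
    (hx : x ∈ p.runs m) (hr : ¬ x.2.1 ≤ r) : ¬ p.sem (x.1, []) x.2.2 ≤ r := by
  intro h
  refine hr (le_trans ?_ h)
  simpa using p.runs_sound m x hx []

end Runs

/-! ### Computability of runs and witnesses -/

section RunsComputability

open Computable

variable {S : Type u} [OmegaContinuousSemiring S] [Primcodable S] [ComputableSemiring S] {k n : ℕ}

theorem computable_runComp :
    Computable₂ (runComp : List (Run k n S) → List (Run k n S) → List (Run k n S)) := by
  let F : Run k n S → Run k n S → List (Run k n S) := fun x y =>
    if x.2.2.1 = y.1 then [(x.1, x.2.1 * y.2.1, y.2.2.1, y.2.2.2 ++ x.2.2.2)] else []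
  have hF : Computable₂ F := by
    have hx : Computable fun z : Run k n S × Run k n S => z.1.2 := snd.comp fst
    have hy : Computable fun z : Run k n S × Run k n S => z.2.2 := snd.comp snd
    have hc : Computable fun z : Run k n S × Run k n S => decide (z.1.2.2.1 = z.2.1) :=
      (Primrec.eq (α := Packet k n)).decide.to_comp.comp (fst.comp (snd.comp hx)) (fst.comp snd)
    have hw : Computable fun z : Run k n S × Run k n S => z.1.2.1 * z.2.2.1 :=
      ComputableSemiring.computable_mul.comp (fst.comp hx) (fst.comp hy)
    have ht : Computable fun z : Run k n S × Run k n S => z.2.2.2.2 ++ z.1.2.2.2 :=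
      list_append.comp (snd.comp (snd.comp hy)) (snd.comp (snd.comp hx))
    have hz : Computable fun z : Run k n S × Run k n S =>
        (z.1.1, z.1.2.1 * z.2.2.1, z.2.2.2.1, z.2.2.2.2 ++ z.1.2.2.2) :=
      pair (fst.comp fst) (pair hw (pair (fst.comp (snd.comp hy)) ht))
    exact computable_ite hc (list_cons.comp hz (const [])) (const [])
  have h : Computable₂ fun (z : List (Run k n S) × List (Run k n S)) (x : Run k n S) =>
      z.2.flatMap (F x) := by
    have hF' : Computable₂ fun (z : (List (Run k n S) × List (Run k n S)) × Run k n S)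
        (y : Run k n S) => F z.2 y := hF.comp (snd.comp fst) snd
    exact computable_list_flatMap (snd.comp fst) hF'
  exact computable_list_flatMap fst h

theorem computable_runIter :
    Computable₂ (runIter : ℕ → List (Run k n S) → List (Run k n S)) := by
  have h : Computable₂ fun (z : ℕ × List (Run k n S)) (y : ℕ × List (Run k n S)) =>
      runSkip ++ runComp z.2 y.2 :=
    list_append.comp (const runSkip)
      (computable_runComp.comp (snd.comp fst) (snd.comp snd))
  exact Computable.nat_rec fst (const runSkip) h

theorem Policy.computable_runs :
    Computable₂ (Policy.runs : ℕ → Policy k n S → List (Run k n S)) := by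
  have hfilter : Computable fun t : Pred k n => (Finset.univ.toList.flatMap fun π =>
      if t.eval π then [(π, 1, π, [])] else [] : List (Run k n S)) := by
    have hpi : Computable fun π : Packet k n => ((π, 1, π, []) : Run k n S) :=
      pair Computable.id (pair (const 1) (pair Computable.id (const [])))
    have h : Computable₂ fun (t : Pred k n) (π : Packet k n) =>
        (if t.eval π then [(π, 1, π, [])] else [] : List (Run k n S)) :=
      computable_ite (Pred.computable_eval.of_eq fun x => by simp)
        (list_cons.comp (hpi.comp snd) (const [])) (const [])
    exact computable_list_flatMap (const _) h
  have hweight : Computable₂ fun (s : S) (l : List (Run k n S)) =>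
      l.map fun x => ((x.1, s * x.2.1, x.2.2) : Run k n S) := by
    have h : Computable₂ fun (z : S × List (Run k n S)) (x : Run k n S) =>
        ((x.1, z.1 * x.2.1, x.2.2) : Run k n S) :=
      pair (fst.comp snd) (pair (ComputableSemiring.computable_mul.comp (fst.comp fst)
        (fst.comp (snd.comp snd))) (snd.comp (snd.comp snd)))
    exact computable_list_map snd h
  exact Policy.computable_fold hfilter computable_runComp hweight list_append computable_runIter

/-- An unbounded search that is known to terminate is computable. -/
theorem exists_computable_search {α : Type v} {β : Type w} [Primcodable α] [Primcodable β]
    {P : α → Prop} (hP : ComputablePred P) {f : α → ℕ → Option β} (hf : Computable₂ f)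
    (H : ∀ a, ¬ P a → ∃ m, (f a m).isSome) :
    ∃ g : α → Option β, Computable g ∧ ∀ a, ¬ P a → ∃ m b, f a m = some b ∧ g a = some b := by
  obtain ⟨_, hP⟩ := hP
  -- On inputs satisfying `P` the search stops at once with the answer `none`; it thus halts
  -- everywhere and defines a total function.
  let F : α → ℕ → Option (Option β) := fun a m => if P a then some none else (f a m).map some
  have hF : Computable₂ F := by
    have h : Computable₂ fun (_ : α × ℕ) (b : β) => some b := option_some.comp snd
    exact computable_ite (hP.comp fst) (const (some none)) (option_map hf h)
  have hdom : ∀ a, (Nat.rfindOpt (F a)).Dom := by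
    intro a
    rw [Nat.rfindOpt_dom]
    by_cases ha : P a
    · exact ⟨0, none, by simp [F, ha]⟩
    · obtain ⟨m, hm⟩ := H a ha
      obtain ⟨b, hb⟩ := Option.isSome_iff_exists.1 hm
      exact ⟨m, some b, by simp [F, ha, hb]⟩
  refine ⟨fun a => (Nat.rfindOpt (F a)).get (hdom a),
    (Partrec.rfindOpt hF).of_eq_tot fun a => Part.get_mem _, fun a ha => ?_⟩
  obtain ⟨m, hm⟩ := Nat.rfindOpt_spec (Part.get_mem (hdom a))
  change ∃ m b, f a m = some b ∧ (Nat.rfindOpt (F a)).get (hdom a) = some b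
  generalize (Nat.rfindOpt (F a)).get (hdom a) = v at hm ⊢
  simp only [F, ha, if_false, Option.mem_def, Option.map_eq_some_iff] at hm
  obtain ⟨b, hb, hb'⟩ := hm
  exact ⟨m, b, hb, hb'.symm⟩

/-- Offending histories can be computed. The order need not be total: sums are suprema, so a sum
that is not below `r` has a term that is not below `r`. -/
theorem exists_computable_witness [AddIsSup S] :
    ∃ witness : Policy k n S → S → Option (Packet k n × History k n),
      Computable₂ witness ∧
      ∀ (p : Policy k n S) (r : S), ¬ p.Safe r →
        ∃ (π : Packet k n) (h : History k n),
          witness p r = some (π, h) ∧ ¬ p.sem (π, []) h ≤ r := by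
  obtain ⟨_, hle⟩ := ComputableSemiring.decidable_le (S := S)
  let f : Policy k n S × S → ℕ → Option (Run k n S) := fun a m =>
    (a.1.runs m).find? fun x => !decide ((x.2.1, a.2).1 ≤ (x.2.1, a.2).2)
  have hf : Computable₂ f := by
    have hp : Computable fun z : ((Policy k n S × S) × ℕ) × Run k n S => (z.2.2.1, z.1.1.2) :=
      pair (fst.comp (snd.comp snd)) (snd.comp (fst.comp fst))
    have h := Primrec.not.to_comp.comp (Computable.comp hle hp)
    exact computable_list_find? (Policy.computable_runs.comp snd (fst.comp fst)) h
  -- Decidability of safety supplies the stopping test, and completeness of runs guarantees success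
  -- on unsafe inputs.
  obtain ⟨g, hg, hg'⟩ := exists_computable_search computablePred_safe hf (by
    rintro ⟨p, r⟩ hp
    obtain ⟨m, x, hx, hr⟩ := Policy.exists_run_of_not_safe hp
    exact ⟨m, List.find?_isSome.2 ⟨x, hx, by simpa using hr⟩⟩)
  refine ⟨fun p r => (g (p, r)).map fun x => (x.1, x.2.2), ?_, fun p r hp => ?_⟩
  · have h : Computable₂ fun (_ : Policy k n S × S) (x : Run k n S) => (x.1, x.2.2) :=
      pair (fst.comp snd) (snd.comp (snd.comp snd))
    exact option_map hg h
  · obtain ⟨m, x, hx, hgx⟩ := hg' (p, r) hp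
    refine ⟨x.1, x.2.2, by simp [hgx], Policy.not_sem_le_of_run (List.mem_of_find?_eq_some hx) ?_⟩
    simpa using List.find?_some hx

end RunsComputability

end WNetKAT

open WNetKAT in
theorem mainTheorem1 {S : Type*} [OmegaContinuousSemiring S] [Primcodable S]
    [ComputableSemiring S]
    (hadd : ∀ s₁ s₂ s₃ : S, s₁ + s₂ ≤ s₃ ↔ s₁ ≤ s₃ ∧ s₂ ≤ s₃) (k n : ℕ) :
    ComputablePred (fun x : Policy k n S × S => x.1.Safe x.2) ∧
    ((∀ a b : S, a ≤ b ∨ b ≤ a) →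
      ∃ witness : Policy k n S → S → Option (Packet k n × History k n),
        Computable₂ witness ∧
        ∀ (p : Policy k n S) (r : S), ¬ p.Safe r →
          ∃ (π : Packet k n) (h : History k n),
            witness p r = some (π, h) ∧ ¬ p.sem (π, []) h ≤ r) := by
  have : AddIsSup S := ⟨hadd⟩
  exact ⟨computablePred_safe, fun _ => exists_computable_witness⟩
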